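/- Let $F\colon\mathbb{R}^n\rightrightarrows\mathbb{R}^m$ be a set-valued mapping whose graph $\mathrm{gph}\,F=\{(x,y)\mid y\in F(x)\}$ is closed. Write $(x_k,y_k)\to(\infty,\overline y)$ if $\|x_k\|\to\infty$ and $y_k\to\overline y$. Let $\overline y\in\mathbb{R}^m$ be a Jelonek value of $F$, i.e. there are $(x_k,y_k)\in\mathrm{gph}\,F$ with $(x_k,y_k)\to(\infty,\overline y)$. Notation: norms and inner products are Euclidean, $\mathbb{B}$ is the closed unit ball, $\mathbb{B}_R=R\,\mathbb{B}$, $F^{-1}(y)=\{x\mid y\in F(x)\}$, $F(A)=\bigcup_{x\in A}F(x)$, and $\mathrm{dist}(\cdot,\emptyset)=+\infty$. For $\Omega\subset\mathbb{R}^n\times\mathbb{R}^m$ and $z\in\Omega$, the regular normal cone $\widehat N_\Omega(z)$ is the set of all $\xi$ with $\langle\xi,z'-z\rangle\le o(\|z'-z\|)$ as $z'\to z$, $z'\in\Omega$. The normal cone $N_\Omega(\infty,\overline y)$ is the set of all limits $\lim_k\xi_k$ with $\xi_k\in\widehat N_\Omega(z_k)$, $z_k\in\Omega$, $z_k\to(\infty,\overline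 y)$. The coderivative of $F$ at $(\infty,\overline y)$ is $D^*F(\infty,\overline y)(v)=\{u\in\mathbb{R}^n\mid (u,-v)\in N_{\mathrm{gph}\,F}(\infty,\overline y)\}$ for $v\in\mathbb{R}^m$, and $\ker D^*F(\infty,\overline y)=\{v\in\mathbb{R}^m\mid 0\in D^*F(\infty,\overline y)(v)\}$. Then the following conditions are equivalent: (i) (coderivative nonsingularity) $\ker D^*F(\infty,\overline y)=\{0\}$. (ii) (linear openness at infinity) There exist constants $R>0$, $\mu>0$, $\epsilon>0$ and a neighborhood $V$ of $\overline y$ such that $$\big(F(x)+\mu r\,\mathbb{B}\big)\cap V\subset F(x+r\,\mathbb{B})\quad\text{for all }x\in\mathbb{R}^n\setminus\mathbb{B}_R\text{ and }r\in(0,\epsilon).$$ (iii) (metric regularity at infinity) There exist constants $R>0$, $\ell>0$, $\gamma>0$ and a neighborhood $V$ of $\overline y$ such that $$\mathrm{dist}(x,F^{-1}(y))\le\ell\,\mathrm{dist}(y,F(x))$$ for all $x\in\mathbb{R}^n\setminus\mathbb{B}_R$ and $y\in V$ with $\mathrm{dist}(y,F(x))<\gamma$. (iv) (inverse Lipschitz-like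 property at infinity) There exist constants $R>0$, $\ell>0$ and a neighborhood $V$ of $\overline y$ such that $$F^{-1}(y')\cap(\mathbb{R}^n\setminus\mathbb{B}_R)\subset F^{-1}(y)+\ell\|y'-y\|\,\mathbb{B}\quad\text{for all }y',y\in V.$$ -/

import Mathlib

open Filter Topology Metric
open scoped Pointwise RealInnerProductSpace

namespace AtInfinity

section Sets

variable {E : Type*} [NormedAddCommGroup E] [InnerProductSpace ℝ E]

/-- The regular (Fréchet) normal cone to `Ω` at `x`: the vectors `ξ` such that
`⟪ξ, x' - x⟫ ≤ o(‖x' - x‖)` as `x' → x` with `x' ∈ Ω`. It is empty if `x ∉ Ω`. -/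
def regularNormalCone (Ω : Set E) (x : E) : Set E :=
  {ξ | x ∈ Ω ∧ ∀ ε : ℝ, 0 < ε → ∀ᶠ x' in 𝓝[Ω] x, ⟪ξ, x' - x⟫ ≤ ε * ‖x' - x‖}

end Sets

section Maps

variable {X Y : Type*}

/-- The inverse of a set-valued mapping `F : X ⇉ Y`. -/
def svInv (F : X → Set Y) (y : Y) : Set X := {x | y ∈ F x}

/-- The image of a set `A` under a set-valued mapping `F : X ⇉ Y`. -/
def svImage (F : X → Set Y) (A : Set X) : Set Y := {y | ∃ x ∈ A, y ∈ F x}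

/-- The kernel of a set-valued mapping. -/
def svKer [Zero Y] (F : X → Set Y) : Set X := {x | (0 : Y) ∈ F x}

/-- The graph of `F : X ⇉ Y`, as a subset of the product `X × Y` with its `ℓ²` (Euclidean)
structure. -/
def svGraph (F : X → Set Y) : Set (WithLp 2 (X × Y)) := {z | z.snd ∈ F z.fst}

end Maps

section Normed

variable {X Y : Type*} [NormedAddCommGroup X] [NormedAddCommGroup Y]

/-- `z k → (∞, ybar)` with `z k ∈ Ω`: the first components leave every bounded set and the
second components converge to `ybar`. -/
def TendstoInfty (Ω : Set (WithLp 2 (X × Y))) (ybar : Y) (z : ℕ → WithLp 2 (X × Y)) : Prop :=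
  (∀ k, z k ∈ Ω) ∧ Tendsto (fun k => ‖(z k).fst‖) atTop atTop ∧
    Tendsto (fun k => (z k).snd) atTop (𝓝 ybar)

/-- The Jelonek set of `F`. -/
def jelonekSet (F : X → Set Y) : Set Y :=
  {y | ∃ z : ℕ → WithLp 2 (X × Y), TendstoInfty (svGraph F) y z}

/-- Linear openness of `F` around `(∞, ybar)`. -/
def LinearlyOpenAtInfty (F : X → Set Y) (ybar : Y) : Prop :=
  ∃ R > (0 : ℝ), ∃ μ > (0 : ℝ), ∃ ε > (0 : ℝ), ∃ V ∈ 𝓝 ybar,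
    ∀ x : X, x ∉ closedBall (0 : X) R → ∀ r ∈ Set.Ioo 0 ε,
      (F x + closedBall (0 : Y) (μ * r)) ∩ V ⊆ svImage F (closedBall x r)

/-- Metric regularity of `F` around `(∞, ybar)`. Distances are extended-real-valued, and the
distance to the empty set is `∞`. -/
def MetricallyRegularAtInfty (F : X → Set Y) (ybar : Y) : Prop :=
  ∃ R > (0 : ℝ), ∃ l > (0 : ℝ), ∃ γ > (0 : ℝ), ∃ V ∈ 𝓝 ybar,
    ∀ x : X, x ∉ closedBall (0 : X) R → ∀ y ∈ V,
      infEDist y (F x) < ENNReal.ofReal γ →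
        infEDist x (svInv F y) ≤ ENNReal.ofReal l * infEDist y (F x)

/-- The Lipschitz-like property of the inverse of `F` around `(ybar, ∞)`. -/
def InvLipschitzLikeAtInfty (F : X → Set Y) (ybar : Y) : Prop :=
  ∃ R > (0 : ℝ), ∃ l > (0 : ℝ), ∃ V ∈ 𝓝 ybar, ∀ y' ∈ V, ∀ y ∈ V,
    svInv F y' ∩ (closedBall (0 : X) R)ᶜ ⊆ svInv F y + closedBall (0 : X) (l * ‖y' - y‖)

end Normed

section Inner

variable {X Y : Type*} [NormedAddCommGroup X] [InnerProductSpace ℝ X]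
  [NormedAddCommGroup Y] [InnerProductSpace ℝ Y]

/-- The normal cone to `Ω ⊆ X × Y` at `(∞, ybar)`: the outer limit of the regular normal cones to
`Ω` at `z`, as `z → (∞, ybar)` in `Ω`. -/
def normalConeAtInfty (Ω : Set (WithLp 2 (X × Y))) (ybar : Y) : Set (WithLp 2 (X × Y)) :=
  {ξ | ∃ z ζ : ℕ → WithLp 2 (X × Y), TendstoInfty Ω ybar z ∧
    (∀ k, ζ k ∈ regularNormalCone Ω (z k)) ∧ Tendsto ζ atTop (𝓝 ξ)}

/-- The coderivative of `F : X ⇉ Y` at `(∞, ybar)`, a set-valued mapping `Y ⇉ X`. -/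
def coderivAtInfty (F : X → Set Y) (ybar : Y) (v : Y) : Set X :=
  {u | WithLp.toLp 2 (u, -v) ∈ normalConeAtInfty (svGraph F) ybar}

end Inner

end AtInfinity

/-! The core is (i) ⇔ (iv); the cycle (iv) → (ii) → (iii) → (iv) only manipulates distances. For (i)
→ (iv), compactness of the unit sphere turns the trivial kernel into a uniform bound `c ≤ ‖u‖` for
regular normals `(u, -v)` near `(∞, ybar)` with `‖v‖ = 1` (`exists_le_norm_of_svKer_eq`). Given `y'
∈ F x₀`, minimize `‖z.snd - y‖ + K * ‖z.fst - x₀‖ ^ 2` over the graph. The minimum is attained in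
finite dimensions, and the penalty has a quadratic upper model where `z.snd ≠ y`, so its negative
gradient is a regular normal there. For suitable `K` this normal violates the bound, so `z.snd = y`
and `z.fst` is the required preimage. For (iv) → (i), testing a regular normal `(u, -v)` on graph
points over `z.snd - t • v` gives `‖v‖ ≤ l * ‖u‖`, which survives the limit. The Jelonek hypothesis
only puts `0` in the kernel. -/

namespace AtInfinity

section Auxiliary

variable {X Y : Type*} [NormedAddCommGroup X] [InnerProductSpace ℝ X]
  [NormedAddCommGroup Y] [InnerProductSpace ℝ Y]

/-! ### Regular normals and the penalty problem -/

/-- Proximal normals are regular normals. -/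
lemma mem_regularNormalCone_of_le_sq {E : Type*} [NormedAddCommGroup E] [InnerProductSpace ℝ E]
    {Ω : Set E} {z ξ : E} (hz : z ∈ Ω) (C : ℝ)
    (h : ∀ z' ∈ Ω, ⟪ξ, z' - z⟫ ≤ C * ‖z' - z‖ ^ 2) : ξ ∈ regularNormalCone Ω z := by
  refine ⟨hz, fun ε hε => ?_⟩
  have hball : ball z (ε / (|C| + 1)) ∈ 𝓝[Ω] z :=
    mem_nhdsWithin_of_mem_nhds (ball_mem_nhds z (by positivity))
  filter_upwards [hball, self_mem_nhdsWithin] with z' hz' hΩ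
  rw [mem_ball, dist_eq_norm, lt_div_iff₀ (by positivity)] at hz'
  have h1 : C * ‖z' - z‖ ≤ ε := by
    nlinarith [norm_nonneg (z' - z), le_abs_self C]
  calc ⟪ξ, z' - z⟫ ≤ C * ‖z' - z‖ ^ 2 := h z' hΩ
    _ = (C * ‖z' - z‖) * ‖z' - z‖ := by ring
    _ ≤ ε * ‖z' - z‖ := by gcongr

lemma zero_mem_regularNormalCone {E : Type*} [NormedAddCommGroup E] [InnerProductSpace ℝ E]
    {Ω : Set E} {z : E} (hz : z ∈ Ω) : (0 : E) ∈ regularNormalCone Ω z :=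
  mem_regularNormalCone_of_le_sq hz 0 (by simp)

/-- The norm lies below its quadratic upper model at a nonzero point. -/
lemma norm_add_le_quadratic {w : Y} (hw : w ≠ 0) (h : Y) :
    ‖w + h‖ ≤ ‖w‖ + ⟪‖w‖⁻¹ • w, h⟫ + (2 * ‖w‖)⁻¹ * ‖h‖ ^ 2 := by
  have hpos : 0 < ‖w‖ := norm_pos_iff.2 hw
  have h1 := norm_add_sq_real w h
  rw [real_inner_smul_left]
  have h2 : ‖w‖ + ‖w‖⁻¹ * ⟪w, h⟫ + (2 * ‖w‖)⁻¹ * ‖h‖ ^ 2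
      = (‖w + h‖ ^ 2 + ‖w‖ ^ 2) / (2 * ‖w‖) := by
    rw [h1]; field_simp; ring
  rw [h2, le_div_iff₀ (by positivity)]
  nlinarith [sq_nonneg (‖w + h‖ - ‖w‖)]

/-- Nonsingularity of the coderivative at infinity gives a lower bound for the first components of
the regular normals near infinity whose second component is a unit vector. -/
lemma exists_le_norm_of_svKer_eq [FiniteDimensional ℝ Y] {F : X → Set Y} {ybar : Y}
    (h : svKer (coderivAtInfty F ybar) = {0}) :
    ∃ c > (0 : ℝ), ∃ R > (0 : ℝ), ∃ δ > (0 : ℝ), ∀ z : WithLp 2 (X × Y), ∀ u : X, ∀ v : Y,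
      R < ‖z.fst‖ → dist z.snd ybar < δ → ‖v‖ = 1 →
      WithLp.toLp 2 (u, -v) ∈ regularNormalCone (svGraph F) z → c ≤ ‖u‖ := by
  by_contra! hcon
  have hk : ∀ k : ℕ, (0 : ℝ) < 1 / ((k : ℝ) + 1) := fun k => Nat.one_div_pos_of_nat
  choose z u v hz hzy hv hN hu using fun k : ℕ =>
    hcon (1 / ((k : ℝ) + 1)) (hk k) ((k : ℝ) + 1) (by positivity) (1 / ((k : ℝ) + 1)) (hk k)
  have hlim := tendsto_one_div_add_atTop_nhds_zero_nat (𝕜 := ℝ)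
  have hu0 : Tendsto u atTop (𝓝 0) :=
    squeeze_zero_norm (fun k => (hu k).le) hlim
  have hzy0 : Tendsto (fun k => (z k).snd) atTop (𝓝 ybar) :=
    tendsto_iff_dist_tendsto_zero.2
      (squeeze_zero (fun _ => dist_nonneg) (fun k => (hzy k).le) hlim)
  have hzx : Tendsto (fun k => ‖(z k).fst‖) atTop atTop :=
    tendsto_atTop_mono (fun k => (lt_add_one (k : ℝ)).le.trans (hz k).le)
      tendsto_natCast_atTop_atTop
  have : ProperSpace Y := FiniteDimensional.proper ℝ Y
  obtain ⟨v₀, hv₀, φ, hφ, hvφ⟩ := (isCompact_sphere (0 : Y) 1).tendsto_subseq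
    (x := v) (fun k => by simpa using hv k)
  have hker : v₀ ∈ svKer (coderivAtInfty F ybar) := by
    refine ⟨z ∘ φ, fun k => WithLp.toLp 2 (u (φ k), -v (φ k)),
      ⟨fun k => (hN (φ k)).1, hzx.comp hφ.tendsto_atTop, hzy0.comp hφ.tendsto_atTop⟩,
      fun k => hN (φ k), ?_⟩
    exact ((WithLp.prod_continuous_toLp 2 X Y).tendsto _).comp
      ((hu0.comp hφ.tendsto_atTop).prodMk_nhds hvφ.neg)
  rw [h, Set.mem_singleton_iff] at hker
  simp [hker] at hv₀

/-- A minimizer of `‖z.snd - y‖ + K * ‖z.fst - x₀‖ ^ 2` over a closed set. -/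
lemma exists_isMinOn_penalty [FiniteDimensional ℝ X] [FiniteDimensional ℝ Y]
    {Ω : Set (WithLp 2 (X × Y))} (hΩ : IsClosed Ω) (hne : Ω.Nonempty) {K : ℝ} (hK : 0 < K)
    (x₀ : X) (y : Y) :
    ∃ z ∈ Ω, IsMinOn (fun z : WithLp 2 (X × Y) => ‖z.snd - y‖ + K * ‖z.fst - x₀‖ ^ 2) Ω z := by
  obtain ⟨z₀, hz₀⟩ := hne
  set f : WithLp 2 (X × Y) → ℝ := fun z => ‖z.snd - y‖ + K * ‖z.fst - x₀‖ ^ 2 with hf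
  have hcont : Continuous f := by
    have h1 : Continuous fun z : WithLp 2 (X × Y) => z.fst :=
      continuous_fst.comp (WithLp.prod_continuous_ofLp 2 X Y)
    have h2 : Continuous fun z : WithLp 2 (X × Y) => z.snd :=
      continuous_snd.comp (WithLp.prod_continuous_ofLp 2 X Y)
    fun_prop
  have : ProperSpace X := FiniteDimensional.proper ℝ X
  have : ProperSpace Y := FiniteDimensional.proper ℝ Y
  have hcomp : IsCompact (Ω ∩ {z | f z ≤ f z₀}) := by
    have hbox : IsCompact (WithLp.toLp 2 ''
        (closedBall x₀ (f z₀ / K + 1) ×ˢ closedBall y (f z₀))) :=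
      ((isCompact_closedBall _ _).prod (isCompact_closedBall _ _)).image
        (WithLp.prod_continuous_toLp 2 X Y)
    refine hbox.of_isClosed_subset (hΩ.inter (isClosed_le hcont continuous_const)) ?_
    rintro z ⟨-, hz⟩
    have hz' : ‖z.snd - y‖ + K * ‖z.fst - x₀‖ ^ 2 ≤ f z₀ := hz
    refine ⟨(z.fst, z.snd), ⟨?_, ?_⟩, rfl⟩
    · rw [mem_closedBall, dist_eq_norm]
      have h1 : ‖z.fst - x₀‖ ^ 2 ≤ f z₀ / K := by
        rw [le_div_iff₀ hK]; nlinarith [norm_nonneg (z.snd - y)]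
      nlinarith [sq_nonneg (‖z.fst - x₀‖ - 1), norm_nonneg (z.fst - x₀)]
    · rw [mem_closedBall, dist_eq_norm]
      nlinarith [mul_nonneg hK.le (sq_nonneg ‖z.fst - x₀‖)]
  obtain ⟨z, hz, hmin⟩ := hcomp.exists_isMinOn ⟨z₀, hz₀, le_refl (f z₀)⟩ hcont.continuousOn
  refine ⟨z, hz.1, fun z' hz' => ?_⟩
  by_cases hle : f z' ≤ f z₀
  · exact hmin ⟨hz', hle⟩
  · exact (show f z ≤ f z₀ from hz.2).trans (not_le.1 hle).le

/-- Fermat's rule for the penalty function: its negative gradient at a minimizer is a regular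
normal. -/
lemma mem_regularNormalCone_of_isMinOn_penalty {Ω : Set (WithLp 2 (X × Y))} {K : ℝ}
    (hK : 0 < K) {x₀ : X} {y : Y} {z : WithLp 2 (X × Y)} (hz : z ∈ Ω) (hzy : z.snd ≠ y)
    (hmin : IsMinOn (fun z : WithLp 2 (X × Y) => ‖z.snd - y‖ + K * ‖z.fst - x₀‖ ^ 2) Ω z) :
    WithLp.toLp 2 (-((2 * K) • (z.fst - x₀)), -(‖z.snd - y‖⁻¹ • (z.snd - y)))
      ∈ regularNormalCone Ω z := by
  have hw : z.snd - y ≠ 0 := sub_ne_zero.2 hzy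
  -- The constant adds the second-order coefficients of the two penalty terms; the extra cross terms
  -- are nonnegative.
  refine mem_regularNormalCone_of_le_sq hz (K + (2 * ‖z.snd - y‖)⁻¹) fun z' hz' => ?_
  have h1 : ‖z.snd - y‖ + K * ‖z.fst - x₀‖ ^ 2 ≤ ‖z'.snd - y‖ + K * ‖z'.fst - x₀‖ ^ 2 := hmin hz'
  have h2 := norm_add_le_quadratic hw (z'.snd - z.snd)
  have h3 := norm_add_sq_real (z.fst - x₀) (z'.fst - z.fst)
  rw [show z.snd - y + (z'.snd - z.snd) = z'.snd - y by abel] at h2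
  rw [show z.fst - x₀ + (z'.fst - z.fst) = z'.fst - x₀ by abel] at h3
  have h4 : ‖z' - z‖ ^ 2 = ‖z'.fst - z.fst‖ ^ 2 + ‖z'.snd - z.snd‖ ^ 2 := by
    simpa using WithLp.prod_norm_sq_eq_of_L2 (z' - z)
  rw [WithLp.prod_inner_apply, h4]
  simp only [WithLp.ofLp_sub, Prod.fst_sub, Prod.snd_sub, inner_neg_left]
  change -⟪(2 * K) • (z.fst - x₀), z'.fst - z.fst⟫ +
    -⟪‖z.snd - y‖⁻¹ • (z.snd - y), z'.snd - z.snd⟫ ≤ _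
  rw [real_inner_smul_left (z.fst - x₀)]
  rw [h3] at h1
  have h5 : 0 ≤ K * ‖z'.snd - z.snd‖ ^ 2 := by positivity
  have h6 : 0 ≤ (2 * ‖z.snd - y‖)⁻¹ * ‖z'.fst - z.fst‖ ^ 2 := by positivity
  linarith

/-! ### Coderivative nonsingularity and the Lipschitz-like inverse -/

theorem invLipschitzLikeAtInfty_of_svKer_eq [FiniteDimensional ℝ X] [FiniteDimensional ℝ Y]
    {F : X → Set Y} (hF : IsClosed (svGraph F)) {ybar : Y}
    (h : svKer (coderivAtInfty F ybar) = {0}) : InvLipschitzLikeAtInfty F ybar := by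
  obtain ⟨c, hc, R, hR, δ, hδ, hbound⟩ := exists_le_norm_of_svKer_eq h
  -- As `‖y' - y‖ < 2 * ρ`, the bound `δ / 3` keeps the minimizer's second component within `δ` of
  -- `ybar`. The bound `c / 8` makes its first component move by less than `1`, so it stays outside
  -- radius `R`.
  set ρ := min (δ / 3) (c / 8) with hρ
  have hρ1 : ρ ≤ δ / 3 := min_le_left _ _
  have hρ2 : ρ ≤ c / 8 := min_le_right _ _
  refine ⟨R + 1, by positivity, 4 / c, by positivity, ball ybar ρ,
    ball_mem_nhds _ (by positivity), ?_⟩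
  rintro y' hy' y hy x₀ ⟨hx₀, hx₀R⟩
  rw [Set.mem_compl_iff, mem_closedBall_zero_iff, not_le] at hx₀R
  rw [mem_ball] at hy hy'
  suffices hx : ∃ x, y ∈ F x ∧ ‖x - x₀‖ ≤ 4 / c * ‖y' - y‖ by
    obtain ⟨x, hx, hxx⟩ := hx
    refine ⟨x, hx, x₀ - x, ?_, by simp⟩
    rwa [mem_closedBall_zero_iff, norm_sub_rev]
  rcases eq_or_ne y' y with rfl | hne
  · exact ⟨x₀, hx₀, by simp⟩
  set a := ‖y' - y‖ with ha
  have ha0 : 0 < a := norm_pos_iff.2 (sub_ne_zero.2 hne)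
  have ha2 : a < 2 * ρ := by
    rw [ha, ← dist_eq_norm]
    linarith [dist_triangle_right y' y ybar]
  -- The penalty equals `a` at `(x₀, y')`, so the minimizer lies within `√(a / K) = 4 * a / c` of
  -- `x₀`. The gradient in the first variable then has norm at most `2 * K * (4 * a / c) = c / 2 <
  -- c`.
  have hK : 0 < c ^ 2 / (16 * a) := by positivity
  obtain ⟨z, hz, hmin⟩ := exists_isMinOn_penalty hF
    ⟨WithLp.toLp 2 (x₀, y'), (hx₀ : y' ∈ F x₀)⟩ hK x₀ y
  have hle : ‖z.snd - y‖ + c ^ 2 / (16 * a) * ‖z.fst - x₀‖ ^ 2 ≤ a := by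
    have := hmin (show WithLp.toLp 2 (x₀, y') ∈ svGraph F from hx₀)
    simpa [ha] using this
  have hx : ‖z.fst - x₀‖ ≤ 4 / c * a := by
    have h1 : c ^ 2 / (16 * a) * ‖z.fst - x₀‖ ^ 2 ≤ a := by linarith [norm_nonneg (z.snd - y)]
    refine abs_le_of_sq_le_sq' ?_ (by positivity) |>.2
    rw [div_mul_eq_mul_div, div_le_iff₀ (by positivity)] at h1
    rw [div_mul_eq_mul_div, div_pow, le_div_iff₀ (by positivity)]
    linarith
  have hy1 : ‖z.snd - y‖ ≤ a := by
    have : 0 ≤ c ^ 2 / (16 * a) * ‖z.fst - x₀‖ ^ 2 := by positivity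
    linarith
  by_cases hzy : z.snd = y
  · exact ⟨z.fst, hzy ▸ hz, hx⟩
  exfalso
  have hN := mem_regularNormalCone_of_isMinOn_penalty hK hz hzy hmin
  have hx1 : 4 / c * a < 1 := by
    rw [div_mul_eq_mul_div, div_lt_one hc]; linarith
  have hzR : R < ‖z.fst‖ := by
    have := norm_sub_norm_le x₀ z.fst
    rw [norm_sub_rev] at this
    linarith
  have hzδ : dist z.snd ybar < δ := by
    have := dist_triangle z.snd y ybar
    rw [dist_eq_norm z.snd y] at this
    linarith
  have hv : ‖‖z.snd - y‖⁻¹ • (z.snd - y)‖ = 1 := by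
    rw [norm_smul, norm_inv, norm_norm]
    exact inv_mul_cancel₀ (norm_ne_zero_iff.2 (sub_ne_zero.2 hzy))
  have hcu := hbound z _ _ hzR hzδ hv hN
  rw [norm_neg, norm_smul, Real.norm_of_nonneg (by positivity)] at hcu
  have : 2 * (c ^ 2 / (16 * a)) * ‖z.fst - x₀‖ ≤ 2 * (c ^ 2 / (16 * a)) * (4 / c * a) := by
    gcongr
  have h2 : 2 * (c ^ 2 / (16 * a)) * (4 / c * a) = c / 2 := by
    field_simp; norm_num
  linarith

/-- Under the Lipschitz-like property of the inverse, the second component of a regular normal near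
infinity is controlled by the first one. -/
lemma norm_le_of_mem_regularNormalCone {F : X → Set Y} {V : Set Y} {l R : ℝ} (hl : 0 < l)
    (hV : ∀ y' ∈ V, ∀ y ∈ V,
      svInv F y' ∩ (closedBall (0 : X) R)ᶜ ⊆ svInv F y + closedBall (0 : X) (l * ‖y' - y‖))
    {z : WithLp 2 (X × Y)} (hzR : R < ‖z.fst‖) (hzV : V ∈ 𝓝 z.snd) {u : X} {v : Y}
    (hN : WithLp.toLp 2 (u, -v) ∈ regularNormalCone (svGraph F) z) : ‖v‖ ≤ l * ‖u‖ := by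
  rcases eq_or_ne v 0 with rfl | hv
  · simp only [norm_zero]; positivity
  have hv0 : 0 < ‖v‖ := norm_pos_iff.2 hv
  refine le_of_forall_pos_le_add fun η hη => ?_
  -- The test displacement has norm at most `(l + 1) * t * ‖v‖`, so this tolerance costs exactly `η`
  -- after division by `t * ‖v‖`.
  have hε : 0 < η / (l + 1) := by positivity
  obtain ⟨s, hs, hball⟩ := Metric.mem_nhdsWithin_iff.1 (hN.2 _ hε)
  obtain ⟨s', hs', hball'⟩ := Metric.mem_nhds_iff.1 hzV
  obtain ⟨t, ht, hts⟩ : ∃ t : ℝ, 0 < t ∧ t * ‖v‖ < min s' (s / (l + 1)) := by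
    refine ⟨min s' (s / (l + 1)) / (2 * ‖v‖), by positivity, ?_⟩
    have : 0 < min s' (s / (l + 1)) := by positivity
    field_simp
    linarith
  have hts1 : t * ‖v‖ < s' := hts.trans_le (min_le_left _ _)
  have hts2 : t * ‖v‖ * (l + 1) < s :=
    (lt_div_iff₀ (by positivity)).1 (hts.trans_le (min_le_right _ _))
  have hnorm : ‖t • v‖ = t * ‖v‖ := by rw [norm_smul, Real.norm_of_nonneg ht.le]
  have hmem : z.snd - t • v ∈ V := hball' (by
    rw [mem_ball, dist_eq_norm, sub_sub_cancel_left, norm_neg, hnorm]; exact hts1)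
  obtain ⟨x, hx, b, hb, hxb⟩ := hV z.snd (mem_of_mem_nhds hzV) _ hmem
    ⟨hN.1, by simpa using hzR⟩
  have hxb : x + b = z.fst := hxb
  rw [sub_sub_cancel, hnorm, mem_closedBall_zero_iff] at hb
  have hdiff : WithLp.toLp 2 (x, z.snd - t • v) - z = WithLp.toLp 2 (-b, -(t • v)) := by
    apply (WithLp.equiv 2 (X × Y)).injective
    change (x - z.fst, z.snd - t • v - z.snd) = (-b, -(t • v))
    rw [← hxb]
    simp
  have hnd : ‖WithLp.toLp 2 (-b, -(t • v))‖ ≤ t * ‖v‖ * (l + 1) := by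
    refine abs_le_of_sq_le_sq' ?_ (by positivity) |>.2
    rw [WithLp.prod_norm_sq_eq_of_L2]
    change ‖-b‖ ^ 2 + ‖-(t • v)‖ ^ 2 ≤ _
    rw [norm_neg, norm_neg, hnorm]
    have h1 : ‖b‖ ^ 2 ≤ (l * (t * ‖v‖)) ^ 2 := by gcongr
    have h2 : 0 ≤ (t * ‖v‖) ^ 2 * l := by positivity
    nlinarith
  have hin : WithLp.toLp 2 (x, z.snd - t • v) ∈ ball z s ∩ svGraph F := by
    refine ⟨?_, hx⟩
    rw [mem_ball, dist_eq_norm, hdiff]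
    exact hnd.trans_lt hts2
  have key : ⟪WithLp.toLp 2 (u, -v), WithLp.toLp 2 (x, z.snd - t • v) - z⟫ ≤
    η / (l + 1) * ‖WithLp.toLp 2 (x, z.snd - t • v) - z‖ := hball hin
  rw [hdiff, WithLp.prod_inner_apply] at key
  change ⟪u, -b⟫ + ⟪-v, -(t • v)⟫ ≤ _ at key
  rw [inner_neg_neg, real_inner_smul_right, real_inner_self_eq_norm_sq, inner_neg_right] at key
  have h1 : ⟪u, b⟫ ≤ ‖u‖ * (l * (t * ‖v‖)) :=
    (real_inner_le_norm u b).trans (by gcongr)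
  have h2 : η / (l + 1) * ‖WithLp.toLp 2 (-b, -(t • v))‖ ≤ η * (t * ‖v‖) := by
    calc η / (l + 1) * ‖WithLp.toLp 2 (-b, -(t • v))‖
        ≤ η / (l + 1) * (t * ‖v‖ * (l + 1)) := by gcongr
      _ = η * (t * ‖v‖) := by field_simp
  have h3 : (t * ‖v‖) * ‖v‖ ≤ (t * ‖v‖) * (l * ‖u‖ + η) := by nlinarith
  exact le_of_mul_le_mul_left h3 (by positivity)

theorem InvLipschitzLikeAtInfty.svKer_eq {F : X → Set Y} {ybar : Y}
    (h : InvLipschitzLikeAtInfty F ybar) (hy : ybar ∈ jelonekSet F) :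
    svKer (coderivAtInfty F ybar) = {0} := by
  obtain ⟨R, -, l, hl, V, hV, hincl⟩ := h
  refine Set.eq_singleton_iff_unique_mem.2 ⟨?_, ?_⟩
  · obtain ⟨z, hz⟩ := hy
    refine ⟨z, fun _ => 0, hz, fun k => zero_mem_regularNormalCone (hz.1 k), ?_⟩
    rw [neg_zero]
    exact tendsto_const_nhds
  · rintro v ⟨z, ζ, ⟨-, hzx, hzy⟩, hζ, hlim⟩
    have hlim' : Tendsto (fun k => ((ζ k).fst, (ζ k).snd)) atTop (𝓝 ((0 : X), -v)) :=
      ((WithLp.prod_continuous_ofLp 2 X Y).tendsto _).comp hlim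
    have hu : Tendsto (fun k => (ζ k).fst) atTop (𝓝 0) := hlim'.fst_nhds
    have hv : Tendsto (fun k => (ζ k).snd) atTop (𝓝 (-v)) := hlim'.snd_nhds
    have hle : ∀ᶠ k in atTop, ‖(ζ k).snd‖ ≤ l * ‖(ζ k).fst‖ := by
      filter_upwards [hzx.eventually_gt_atTop R, hzy.eventually (eventually_mem_nhds_iff.2 hV)]
        with k hk1 hk2
      have := norm_le_of_mem_regularNormalCone hl hincl hk1 hk2 (u := (ζ k).fst)
        (v := -(ζ k).snd) (by rw [neg_neg]; exact hζ k)
      rwa [norm_neg] at this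
    have := le_of_tendsto_of_tendsto hv.norm (hu.norm.const_mul l) hle
    simpa using this

/-! ### Metric equivalences -/

theorem LinearlyOpenAtInfty.metricallyRegularAtInfty {X Y : Type*} [NormedAddCommGroup X]
    [NormedAddCommGroup Y] {F : X → Set Y} {ybar : Y}
    (h : LinearlyOpenAtInfty F ybar) : MetricallyRegularAtInfty F ybar := by
  obtain ⟨R, hR, μ, hμ, ε, hε, V, hV, hop⟩ := h
  refine ⟨R, hR, μ⁻¹, by positivity, μ * ε, by positivity, V, hV, fun x hx y hy hd => ?_⟩
  -- The distance to `F x` may be zero or not attained, so openness is applied with radius `d / μ`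
  -- for `d` strictly above it, and then `d` decreases to the distance.
  have hbd : ∀ d : ENNReal, infEDist y (F x) < d → d < ENNReal.ofReal (μ * ε) →
      infEDist x (svInv F y) ≤ ENNReal.ofReal μ⁻¹ * d := by
    intro d hd1 hd2
    have hdtop : d ≠ ⊤ := (hd2.trans ENNReal.ofReal_lt_top).ne
    have hd0 : 0 < d.toReal := ENNReal.toReal_pos (bot_le.trans_lt hd1).ne' hdtop
    obtain ⟨y₀, hy₀, hyy⟩ := infEDist_lt_iff.1 hd1
    have hyy' : dist y y₀ ≤ d.toReal := by
      rw [dist_edist]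
      exact ENNReal.toReal_mono hdtop hyy.le
    have hdε : d.toReal < μ * ε := (ENNReal.lt_ofReal_iff_toReal_lt hdtop).1 hd2
    obtain ⟨x', hx', hyx'⟩ := hop x hx (μ⁻¹ * d.toReal)
      ⟨by positivity, by rw [inv_mul_lt_iff₀ hμ]; exact hdε⟩
      ⟨⟨y₀, hy₀, y - y₀, by
        rw [mem_closedBall_zero_iff, ← dist_eq_norm, mul_inv_cancel_left₀ hμ.ne']
        exact hyy', by simp⟩, hy⟩
    rw [mem_closedBall, dist_comm] at hx'
    calc infEDist x (svInv F y) ≤ edist x x' := infEDist_le_edist_of_mem hyx'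
      _ ≤ ENNReal.ofReal (μ⁻¹ * d.toReal) := by
        rw [edist_dist]; exact ENNReal.ofReal_le_ofReal hx'
      _ = ENNReal.ofReal μ⁻¹ * d := by
        rw [ENNReal.ofReal_mul (by positivity), ENNReal.ofReal_toReal hdtop]
  have : (𝓝[>] infEDist y (F x)).NeBot := nhdsGT_neBot_of_exists_gt ⟨_, hd⟩
  have hlim : Tendsto (fun d => ENNReal.ofReal μ⁻¹ * d) (𝓝[>] infEDist y (F x))
      (𝓝 (ENNReal.ofReal μ⁻¹ * infEDist y (F x))) :=
    (ENNReal.Tendsto.const_mul tendsto_id (Or.inr ENNReal.ofReal_ne_top)).mono_left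
      nhdsWithin_le_nhds
  refine ge_of_tendsto hlim ?_
  filter_upwards [Ioo_mem_nhdsGT hd] with d hd'
  exact hbd d hd'.1 hd'.2

theorem MetricallyRegularAtInfty.invLipschitzLikeAtInfty {X Y : Type*} [NormedAddCommGroup X]
    [ProperSpace X] [NormedAddCommGroup Y] {F : X → Set Y} {ybar : Y}
    (hF : ∀ y, IsClosed (svInv F y)) (h : MetricallyRegularAtInfty F ybar) :
    InvLipschitzLikeAtInfty F ybar := by
  obtain ⟨R, hR, l, hl, γ, hγ, V, hV, hreg⟩ := h
  -- Two points of this ball are less than `γ` apart, which activates the regularity estimate.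
  refine ⟨R, hR, l, hl, V ∩ ball ybar (γ / 2),
    inter_mem hV (ball_mem_nhds _ (by positivity)), ?_⟩
  rintro y' ⟨-, hy'⟩ y ⟨hyV, hy⟩ x ⟨hx, hxR⟩
  have hd : infEDist y (F x) ≤ ENNReal.ofReal ‖y' - y‖ := by
    rw [← dist_eq_norm, ← edist_dist, edist_comm]
    exact infEDist_le_edist_of_mem hx
  have hlt : ‖y' - y‖ < γ := by
    rw [← dist_eq_norm]
    rw [mem_ball] at hy hy'
    linarith [dist_triangle_right y' y ybar]
  have hle : infEDist x (svInv F y) ≤ ENNReal.ofReal (l * ‖y' - y‖) := by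
    rw [ENNReal.ofReal_mul hl.le]
    exact (hreg x hxR y hyV (hd.trans_lt ((ENNReal.ofReal_lt_ofReal_iff hγ).2 hlt))).trans
      (by gcongr)
  have hne : (svInv F y).Nonempty := by
    by_contra hempty
    rw [Set.not_nonempty_iff_eq_empty.1 hempty, infEDist_empty, top_le_iff] at hle
    exact ENNReal.ofReal_ne_top hle
  -- Closed fibres in a proper space have nearest points, so the constant `l` is kept without loss.
  obtain ⟨x', hx', hxx'⟩ := (hF y).exists_infDist_eq_dist hne x
  refine ⟨x', hx', x - x', ?_, by simp⟩
  rw [mem_closedBall_zero_iff, ← dist_eq_norm, ← hxx']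
  exact ENNReal.toReal_le_of_le_ofReal (by positivity) hle

theorem InvLipschitzLikeAtInfty.linearlyOpenAtInfty {X Y : Type*} [NormedAddCommGroup X]
    [NormedAddCommGroup Y] {F : X → Set Y} {ybar : Y}
    (h : InvLipschitzLikeAtInfty F ybar) : LinearlyOpenAtInfty F ybar := by
  obtain ⟨R, hR, l, hl, V, hV, hincl⟩ := h
  obtain ⟨δ, hδ, hball⟩ := Metric.mem_nhds_iff.1 hV
  -- With `r < l * (δ / 2)`, a perturbation of size `l⁻¹ * r` is below `δ / 2`, so `y'` remains in
  -- `ball ybar δ ⊆ V`.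
  refine ⟨R, hR, l⁻¹, by positivity, l * (δ / 2), by positivity, ball ybar (δ / 2),
    ball_mem_nhds _ (by positivity), ?_⟩
  rintro x hx r ⟨hr, hrε⟩ y ⟨⟨y', hy', b, hb, hyb⟩, hy⟩
  have hyb : y' + b = y := hyb
  rw [mem_closedBall_zero_iff] at hb
  have hbδ : l⁻¹ * r < δ / 2 := (inv_mul_lt_iff₀ hl).2 hrε
  have hdist : ‖y' - y‖ = ‖b‖ := by rw [← hyb, sub_add_cancel_left, norm_neg]
  rw [mem_ball] at hy
  have hy'V : y' ∈ V := hball (by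
    rw [mem_ball]
    have := dist_triangle y' y ybar
    rw [dist_eq_norm y' y, hdist] at this
    linarith)
  have hyV : y ∈ V := hball (by rw [mem_ball]; linarith)
  obtain ⟨x', hx', e, he, hxe⟩ := hincl y' hy'V y hyV ⟨hy', hx⟩
  have hxe : x' + e = x := hxe
  refine ⟨x', ?_, hx'⟩
  rw [mem_closedBall_zero_iff, hdist] at he
  rw [mem_closedBall, dist_eq_norm, ← hxe, sub_add_cancel_left, norm_neg]
  calc ‖e‖ ≤ l * ‖b‖ := he
    _ ≤ l * (l⁻¹ * r) := by gcongr
    _ = r := mul_inv_cancel_left₀ hl.ne' r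

lemma isClosed_svInv {X Y : Type*} [NormedAddCommGroup X] [NormedAddCommGroup Y] {F : X → Set Y}
    (hF : IsClosed (svGraph F)) (y : Y) : IsClosed (svInv F y) :=
  hF.preimage ((WithLp.prod_continuous_toLp 2 X Y).comp (Continuous.prodMk_left y))

end Auxiliary

end AtInfinity

theorem theorem4p1 (n m : ℕ)
    (F : EuclideanSpace ℝ (Fin n) → Set (EuclideanSpace ℝ (Fin m)))
    (hF : IsClosed (AtInfinity.svGraph F))
    (ybar : EuclideanSpace ℝ (Fin m)) (hy : ybar ∈ AtInfinity.jelonekSet F) :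
    List.TFAE
      [AtInfinity.svKer (AtInfinity.coderivAtInfty F ybar) = {0},
        AtInfinity.LinearlyOpenAtInfty F ybar,
        AtInfinity.MetricallyRegularAtInfty F ybar,
        AtInfinity.InvLipschitzLikeAtInfty F ybar] := by
  tfae_have 1 → 4 := AtInfinity.invLipschitzLikeAtInfty_of_svKer_eq hF
  tfae_have 4 → 1 := fun h => h.svKer_eq hy
  tfae_have 4 → 2 := fun h => h.linearlyOpenAtInfty
  tfae_have 2 → 3 := fun h => h.metricallyRegularAtInfty
  tfae_have 3 → 4 := fun h => h.invLipschitzLikeAtInfty (AtInfinity.isClosed_svInv hF)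
  tfae_finish
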